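/- All graphs are finite, simple, undirected and uncolored. Weisfeiler-Leman equivalence. Let $k\ge 1$ and let $G$ be a graph with $n$ vertices. For $\bar x=(x_1,\dots,x_k)\in V(G)^k$ let $\mathrm{WL}_k^0(G,\bar x)$ be the $k\times k$ matrix whose $(i,j)$ entry is $1$ if $x_ix_j\in E(G)$, $2$ if $x_i=x_j$, and $0$ otherwise. For $r\ge 0$ let $$\mathrm{WL}_1^{r+1}(G,x)=\bigl(\mathrm{WL}_1^{r}(G,x),\ \{\!\!\{\mathrm{WL}_1^{r}(G,y): y\in N(x)\}\!\!\}\bigr)$$ if $k=1$, and, if $k\ge 2$, $$\mathrm{WL}_k^{r+1}(G,\bar x)=\bigl(\mathrm{WL}_k^{r}(G,\bar x),\ \{\!\!\{(\mathrm{WL}_k^{r}(G,\bar x_1^u),\dots,\mathrm{WL}_k^{r}(G,\bar x_k^u)): u\in V(G)\}\!\!\}\bigr),$$ where $\bar x_i^u$ is $\bar x$ with $x_i$ replaced by $u$ and $\{\!\!\{\ \}\!\!\}$ denotes a multiset. Put $\mathrm{WL}_k(G)=\{\!\!\{\mathrm{WL}_k^{n^k}(G,\bar x):\bar x\in V(G)^k\}\!\!\}$.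 Graphs $G$ and $H$ are $\mathrm{WL}_k$-equivalent if $\mathrm{WL}_k(G)=\mathrm{WL}_k(H)$. Homomorphism-hereditary treewidth. For a graph $F$, let $\mathrm{htw}(F)$ be the maximum treewidth of a homomorphic image of $F$, that is, of a graph $F'$ such that there is a homomorphism from $F$ to $F'$ that is surjective on vertices and on edges. Fractional packing. For a finite hypergraph $\mathcal S$ on a vertex set $V$, the fractional matching number $\nu_f(\mathcal S)$ is the optimum value of the linear program that maximizes $\sum_{e\in\mathcal S}x_e$ subject to $x_e\ge 0$ for every $e\in\mathcal S$ and $\sum_{e\in\mathcal S,\,e\ni v}x_e\le 1$ for every $v\in V$ (with the value $+\infty$ if the program is unbounded, which happens only if $\emptyset\in\mathcal S$). The fractional $F$-packing number of $G$ is $\pi_f^F(G)=\nu_f(\mathcal S_{F,G})$, where $\mathcal S_{F,G}=\{V(S): S \text{ is a subgraph of } G \text{ isomorphic to } F\}$. Theorem. Let $F$ be a graph and $k\ge 1$ an integer. If $\mathrm{htw}(F)\le k$, then $\pi_f^F$ is $\mathrm{WL}_k$-invariant: $\pi_f^F(G)=\pi_f^F(H)$ for all $\mathrm{WL}_k$-equivalent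 graphs $G$ and $H$. -/

import Mathlib

universe u v w

namespace FracPacking

/-! ### The `k`-dimensional Weisfeiler-Leman procedure -/

/-- The type of the colors used by `k`-dimensional Weisfeiler-Leman in round `r`. It does not depend
on the input graph, so colors computed on different graphs can be compared. A color of round `0` is
a `k × k` matrix; a color of round `r + 1` is a pair of a color of round `r` and a multiset of
`k`-tuples of colors of round `r`. -/
def WLColor (k : ℕ) : ℕ → Type
  | 0 => Matrix (Fin k) (Fin k) (Fin 3)
  | r + 1 => WLColor k r × Multiset (Fin k → WLColor k r)

open Classical in
/-- The ordered isomorphism type of the tuple `x` in `G`: the `(i, j)` entry is `1` if `x i` and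
`x j` are adjacent, `2` if they are equal, and `0` otherwise. -/
noncomputable def orderedIsoType {V : Type u} (G : SimpleGraph V) (k : ℕ) (x : Fin k → V) :
    Matrix (Fin k) (Fin k) (Fin 3) :=
  Matrix.of fun i j => if G.Adj (x i) (x j) then 1 else if x i = x j then 2 else 0

open Classical in
/-- The vertices `u` that are substituted into the tuple `x` in a refinement round: the neighbors of
the only entry of `x` if `k = 1`, and all the vertices if `k ≠ 1`. -/
noncomputable def substVertices {V : Type u} [Fintype V] (G : SimpleGraph V) (k : ℕ)
    (x : Fin k → V) : Finset V :=
  if k = 1 then Finset.univ.filter (fun u => ∀ i, G.Adj (x i) u) else Finset.univ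

/-- The color of the tuple `x` after `r` rounds of `k`-dimensional Weisfeiler-Leman. One round
replaces the color of `x` by the pair of this color and the multiset, over all `u` to be
substituted, of the tuples of the colors of `x` with its `i`-th entry replaced by `u`. -/
noncomputable def wlColor {V : Type u} [Fintype V] (G : SimpleGraph V) (k : ℕ) :
    (r : ℕ) → (Fin k → V) → WLColor k r
  | 0, x => orderedIsoType G k x
  | r + 1, x => (wlColor G k r x, (substVertices G k x).val.map
      fun u i => wlColor G k r (Function.update x i u))

/-- The result of `k`-dimensional Weisfeiler-Leman on a graph `G` with `n` vertices: the multiset of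
the colors of all the `k`-tuples after `n ^ k` rounds (together with the number of rounds). -/
noncomputable def wlPalette {V : Type u} [Fintype V] (G : SimpleGraph V) (k : ℕ) :
    Σ r : ℕ, Multiset (WLColor k r) :=
  ⟨Fintype.card V ^ k,
    (Finset.univ : Finset (Fin k → V)).val.map (wlColor G k (Fintype.card V ^ k))⟩

/-- `WL_k`-equivalence of graphs. -/
def WLEquiv (k : ℕ) {V : Type u} {W : Type v} [Fintype V] [Fintype W]
    (G : SimpleGraph V) (H : SimpleGraph W) : Prop :=
  wlPalette G k = wlPalette H k

/-! ### Treewidth -/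

/-- A tree decomposition of a graph. -/
structure TreeDecomposition {V : Type u} (F : SimpleGraph V) where
  /-- The nodes of the tree. -/
  node : Type
  finite_node : Finite node
  /-- The tree. -/
  tree : SimpleGraph node
  isTree : tree.IsTree
  /-- The bags. -/
  bag : node → Set V
  exists_mem_bag : ∀ x, ∃ t, x ∈ bag t
  exists_adj_mem_bag : ∀ x y, F.Adj x y → ∃ t, x ∈ bag t ∧ y ∈ bag t
  preconnected : ∀ x, (tree.induce {t | x ∈ bag t}).Preconnected

/-- The width of a tree decomposition: the maximum size of a bag, minus one. -/
noncomputable def TreeDecomposition.width {V : Type u} {F : SimpleGraph V}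
    (D : TreeDecomposition F) : ℕ∞ :=
  (⨆ t, (D.bag t).encard) - 1

/-- The treewidth of a graph: the minimum width of a tree decomposition. -/
noncomputable def treewidth {V : Type u} (F : SimpleGraph V) : ℕ∞ :=
  ⨅ D : TreeDecomposition F, D.width

/-- `F'` is a homomorphic image of `F`: there is a homomorphism from `F` to `F'` that is surjective
on vertices and on edges. -/
def IsHomImage {V : Type u} {W : Type v} (F : SimpleGraph V) (F' : SimpleGraph W) : Prop :=
  ∃ h : F →g F', Function.Surjective h ∧ Function.Surjective h.mapEdgeSet

/-- The homomorphism-hereditary treewidth of `F`: the maximum treewidth of a homomorphic image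
of `F`. -/
noncomputable def htw {V : Type u} (F : SimpleGraph V) : ℕ∞ :=
  sSup {t | ∃ (W : Type u) (F' : SimpleGraph W), IsHomImage F F' ∧ t = treewidth F'}

/-! ### Fractional packing -/

open Classical in
/-- Feasible solutions of the linear program of a hypergraph `S`: nonnegative weights on the
hyperedges such that, for every vertex, the weights of the hyperedges containing it sum up to at
most `1`. -/
def IsFractionalMatching {V : Type u} (S : Finset (Finset V)) (x : S → ℝ) : Prop :=
  (∀ e, 0 ≤ x e) ∧ ∀ v : V, ∑ e with v ∈ e.1, x e ≤ 1

/-- The fractional matching number of a hypergraph: the optimum value of its linear program. It is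
an extended real because the program is unbounded if the empty set is a hyperedge. -/
noncomputable def fracMatchingNumber {V : Type u} (S : Finset (Finset V)) : EReal :=
  ⨆ (x : S → ℝ) (_ : IsFractionalMatching S x), ((∑ e, x e : ℝ) : EReal)

open Classical in
/-- The hypergraph on `V(G)` whose hyperedges are the vertex sets of the subgraphs of `G` isomorphic
to `F`. -/
noncomputable def packingHypergraph {U : Type w} {V : Type u} [Fintype V]
    (F : SimpleGraph U) (G : SimpleGraph V) : Finset (Finset V) :=
  Finset.univ.filter fun e => ∃ S : G.Subgraph, Nonempty (S.coe ≃g F) ∧ S.verts = ↑e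

/-- The fractional `F`-packing number of `G`. -/
noncomputable def fracPackingNumber {U : Type w} {V : Type u} [Fintype V]
    (F : SimpleGraph U) (G : SimpleGraph V) : EReal :=
  fracMatchingNumber (packingHypergraph F G)

end FracPacking

/-! Give each vertex `v` the stable color of the constant tuple `(v, …, v)`. The proof moves a
fractional matching from `G` to `H`: the weight of a copy of `F` in `G` is spread evenly over all
embeddings of `F` into `H` with the same color pattern. The load on a vertex `w` is then at most the
average load on the vertices of `G` of its color, hence at most `1`, and the total is kept
(`fracMatchingNumber_le_of_colored`). Symmetry gives equality.

This needs the number of embeddings with prescribed colors and prescribed image of a root to depend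
only on the color of that image, across both graphs. Equality of stable colors is a bisimulation
(`WLEquiv.exists_isBisimulation`), so such counts agree for homomorphisms from graphs of treewidth
at most `k` (`sum_eq_of_treewidth_le`). Homomorphisms from `F` whose kernel contains a partition `θ`
are homomorphisms from `F/θ`, a homomorphic image of `F`, so `htw F ≤ k` covers them all; inversion
over the partitions isolates the injective ones (`card_injective_isColoredHom_eq`). -/

namespace FracPacking

open Finset Function

/-! ### Bisimulations between tuples of two graphs -/

section Bisimulation

variable {V : Type u} {W : Type v} {G : SimpleGraph V} {H : SimpleGraph W} {k : ℕ}

/-- Two families have the same multiset of values only if some bijection of the index types matches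
their values. -/
theorem exists_equiv_of_map_univ_eq {Γ : Type*} [Fintype V] [Fintype W] {f : V → Γ} {g : W → Γ}
    (h : (univ : Finset V).val.map f = (univ : Finset W).val.map g) :
    ∃ σ : V ≃ W, ∀ u, f u = g (σ u) := by
  classical
  have key : ∀ c, Nonempty ({a // f a = c} ≃ {b // g b = c}) := fun c => by
    rw [← Fintype.card_eq, Fintype.card_subtype, Fintype.card_subtype]
    have := congrArg (Multiset.count c) h
    rw [Multiset.count_map, Multiset.count_map] at this
    simpa [Finset.card_def, eq_comm] using this
  exact ⟨Equiv.ofFiberEquiv fun c => (key c).some,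
    fun u => (Equiv.ofFiberEquiv_map (fun c => (key c).some) u).symm⟩

theorem orderedIsoType_eq_one_iff (x : Fin k → V) (i j : Fin k) :
    orderedIsoType G k x i j = 1 ↔ G.Adj (x i) (x j) := by
  simp only [orderedIsoType, Matrix.of_apply]
  split_ifs <;> simp_all

theorem adj_iff_of_orderedIsoType_eq {x : Fin k → V} {y : Fin k → W}
    (h : orderedIsoType G k x = orderedIsoType H k y) (i j : Fin k) :
    G.Adj (x i) (x j) ↔ H.Adj (y i) (y j) := by
  rw [← orderedIsoType_eq_one_iff, ← orderedIsoType_eq_one_iff, h]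

/-- A relation between the `k`-tuples of two graphs which respects the ordered isomorphism types and
has the back-and-forth property of the bijective pebble game. -/
structure IsBisimulation (G : SimpleGraph V) (H : SimpleGraph W) (k : ℕ)
    (R : (Fin k → V) → (Fin k → W) → Prop) : Prop where
  iso : ∀ {x y}, R x y → orderedIsoType G k x = orderedIsoType H k y
  exists_equiv : ∀ {x y}, R x y → ∃ σ : V ≃ W, ∀ u,
    (∀ i, R (update x i u) (update y i (σ u))) ∧ ∀ i, G.Adj (x i) u ↔ H.Adj (y i) (σ u)

/-- The `k - 1` indices other than `i` cannot cover `Fin k` under `π`, so some slot `m` is free.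
Substituting into a reindexed tuple thus amounts to substituting at `m` and then reindexing. -/
theorem exists_eq_and_forall_ne (π : Fin k → Fin k) (i : Fin k) :
    ∃ (m : Fin k) (π' : Fin k → Fin k), π' i = m ∧ ∀ j ≠ i, π' j = π j ∧ π j ≠ m := by
  classical
  have hlt : ((univ.erase i).image π).card < (univ : Finset (Fin k)).card :=
    card_image_le.trans_lt (card_lt_card (erase_ssubset (mem_univ i)))
  obtain ⟨m, -, hm⟩ := exists_mem_notMem_of_card_lt_card hlt
  refine ⟨m, update π i m, by simp, fun j hj => ⟨by simp [hj], ?_⟩⟩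
  rintro rfl
  exact hm (mem_image_of_mem _ (by simp [hj]))

theorem update_comp_eq {X : Type*} {π π' : Fin k → Fin k} {i m : Fin k} (hi : π' i = m)
    (h : ∀ j ≠ i, π' j = π j ∧ π j ≠ m) (x : Fin k → X) (u : X) :
    update (x ∘ π) i u = update x m u ∘ π' := by
  ext j
  by_cases hj : j = i
  · simp [hj, hi]
  · simp [hj, h j hj]

/-- Bisimilar tuples have the same colors, and so do the tuples obtained by reindexing. -/
theorem IsBisimulation.wlColor_comp_eq [Fintype V] [Fintype W]
    {R : (Fin k → V) → (Fin k → W) → Prop} (hR : IsBisimulation G H k R) (s : ℕ) :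
    ∀ {x y}, R x y → ∀ π : Fin k → Fin k, wlColor G k s (x ∘ π) = wlColor H k s (y ∘ π) := by
  induction s with
  | zero =>
    intro x y hxy π
    have := hR.iso hxy
    refine Matrix.ext fun i j => ?_
    exact congrFun (congrFun this (π i)) (π j)
  | succ s ih =>
    intro x y hxy π
    refine Prod.ext (ih hxy π) ?_
    obtain ⟨σ, hσ⟩ := hR.exists_equiv hxy
    have hsub : substVertices H k (y ∘ π) = (substVertices G k (x ∘ π)).map σ.toEmbedding := by
      unfold substVertices
      split_ifs
      · ext w
        obtain ⟨u, rfl⟩ := σ.surjective w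
        simp [(hσ u).2]
      · simp
    change Multiset.map _ _ = Multiset.map _ _
    rw [hsub, Finset.map_val, Multiset.map_map]
    refine Multiset.map_congr rfl fun u _ => funext fun i => ?_
    obtain ⟨m, π', hi, h⟩ := exists_eq_and_forall_ne π i
    change wlColor G k s (update (x ∘ π) i u) = wlColor H k s (update (y ∘ π) i (σ u))
    rw [update_comp_eq hi h, update_comp_eq hi h]
    exact ih ((hσ u).1 m) π'

end Bisimulation

/-! ### Stable colors form a bisimulation -/

section Stabilization

variable {V : Type u} {W : Type v} [Fintype V] [Fintype W] {G : SimpleGraph V}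
  {H : SimpleGraph W} {k : ℕ}

/-- The color of the preceding round. -/
def WLColor.prev {r : ℕ} (c : WLColor k (r + 1)) : WLColor k r := c.1

theorem prev_wlColor (r : ℕ) (x : Fin k → V) :
    (wlColor G k (r + 1) x).prev = wlColor G k r x := rfl

theorem orderedIsoType_eq_of_wlColor_eq {r : ℕ} {x : Fin k → V} {y : Fin k → W}
    (h : wlColor G k r x = wlColor H k r y) : orderedIsoType G k x = orderedIsoType H k y := by
  induction r with
  | zero => exact h
  | succ r ih => exact ih (congrArg Prod.fst h)

theorem map_wlColor_eq_of_le {N : ℕ}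
    (h : (univ : Finset (Fin k → V)).val.map (wlColor G k N) =
      (univ : Finset (Fin k → W)).val.map (wlColor H k N)) {s : ℕ} (hs : s ≤ N) :
    (univ : Finset (Fin k → V)).val.map (wlColor G k s) =
      (univ : Finset (Fin k → W)).val.map (wlColor H k s) := by
  refine Nat.decreasingInduction' (P := fun s => (univ : Finset (Fin k → V)).val.map
    (wlColor G k s) = (univ : Finset (Fin k → W)).val.map (wlColor H k s))
    (fun s _ _ ih => ?_) hs h
  have := congrArg (Multiset.map WLColor.prev) ih
  simpa only [Multiset.map_map, Function.comp_def, prev_wlColor] using this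

open Classical in
/-- On a graph with `n ≥ 1` vertices, some round before the round `n ^ k` does not refine the color
partition of the `k`-tuples. -/
theorem exists_wlColor_stable [Nonempty V] (G : SimpleGraph V) (k : ℕ) :
    ∃ r < Fintype.card V ^ k, ∀ x y : Fin k → V,
      wlColor G k r x = wlColor G k r y → wlColor G k (r + 1) x = wlColor G k (r + 1) y := by
  by_contra! hcon
  -- If each round refined strictly, round `r` would have at least `r + 1` colors, too many for `n ^
  -- k` tuples at `r = n ^ k`.
  have hgrow : ∀ r ≤ Fintype.card V ^ k,
      r + 1 ≤ ((univ : Finset (Fin k → V)).image (wlColor G k r)).card := by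
    intro r
    induction r with
    | zero => exact fun _ => card_pos.2 (univ_nonempty.image _)
    | succ r ih =>
      intro hr
      refine Nat.succ_le_of_lt ((ih (by omega)).trans_lt ?_)
      have himg : (univ : Finset (Fin k → V)).image (wlColor G k r) =
          ((univ : Finset (Fin k → V)).image (wlColor G k (r + 1))).image WLColor.prev := by
        rw [image_image]; rfl
      rw [himg]
      refine lt_of_le_of_ne card_image_le fun heq => ?_
      obtain ⟨x, y, hxy, hne⟩ := hcon r (by omega)
      exact hne (card_image_iff.1 heq (by simp) (by simp) hxy)
  have h₁ := hgrow _ le_rfl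
  have h₂ : ((univ : Finset (Fin k → V)).image
    (wlColor G k (Fintype.card V ^ k))).card ≤ Fintype.card V ^ k :=
    card_image_le.trans (by simp)
  omega

/-- For `k ≥ 2`, the adjacency of `x i` and `u` is visible in the color obtained by putting `u` into
another slot `j`. For `k = 1` there is no other slot: the colors of the neighbors match, and
subtracting them from the whole palette `hpal` matches the non-neighbors. -/
theorem exists_equiv_of_wlColor_succ_eq (hk : 1 ≤ k) {r : ℕ}
    (hpal : (univ : Finset (Fin k → V)).val.map (wlColor G k r) =
      (univ : Finset (Fin k → W)).val.map (wlColor H k r))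
    {x : Fin k → V} {y : Fin k → W}
    (h : wlColor G k (r + 1) x = wlColor H k (r + 1) y) :
    ∃ σ : V ≃ W, ∀ u, (∀ i, wlColor G k r (update x i u) = wlColor H k r (update y i (σ u))) ∧
      ∀ i, G.Adj (x i) u ↔ H.Adj (y i) (σ u) := by
  classical
  have h₂ := congrArg Prod.snd h
  change Multiset.map _ _ = Multiset.map _ _ at h₂
  rcases eq_or_lt_of_le hk with rfl | hk
  · let a : V → WLColor 1 r := fun u => wlColor G 1 r fun _ => u
    let b : W → WLColor 1 r := fun u => wlColor H 1 r fun _ => u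
    let P : V → Prop := fun u => G.Adj (x 0) u
    let Q : W → Prop := fun u => H.Adj (y 0) u
    have hN : ((univ : Finset V).val.filter P).map a = ((univ : Finset W).val.filter Q).map b := by
      have := congrArg (Multiset.map fun c => c 0) h₂
      simp [substVertices, Multiset.map_map,
        update_eq_const_of_subsingleton] at this
      exact this
    have hT : (univ : Finset V).val.map a = (univ : Finset W).val.map b := by
      rw [← Multiset.map_univ_val_equiv (Equiv.funUnique (Fin 1) V).symm,
        ← Multiset.map_univ_val_equiv (Equiv.funUnique (Fin 1) W).symm, Multiset.map_map,
        Multiset.map_map] at hpal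
      exact hpal
    have hC : ((univ : Finset V).val.filter (¬ P ·)).map a =
        ((univ : Finset W).val.filter (¬ Q ·)).map b := by
      rw [← Multiset.filter_add_not P univ.val, ← Multiset.filter_add_not Q univ.val, Multiset.map_add,
        Multiset.map_add, hN] at hT
      exact add_left_cancel hT
    have hall : (univ : Finset V).val.map (fun u => (a u, P u)) =
        (univ : Finset W).val.map (fun u => (b u, Q u)) := by
      rw [← Multiset.filter_add_not P univ.val, ← Multiset.filter_add_not Q univ.val, Multiset.map_add,
        Multiset.map_add]
      congr 1
      · have := congrArg (Multiset.map fun c => (c, True)) hN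
        rw [Multiset.map_map, Multiset.map_map] at this
        convert this using 1 <;>
          exact Multiset.map_congr rfl fun u hu => by simpa using (Multiset.mem_filter.1 hu).2
      · have := congrArg (Multiset.map fun c => (c, False)) hC
        rw [Multiset.map_map, Multiset.map_map] at this
        convert this using 1 <;>
          exact Multiset.map_congr rfl fun u hu => by simpa using (Multiset.mem_filter.1 hu).2
    obtain ⟨σ, hσ⟩ := exists_equiv_of_map_univ_eq hall
    refine ⟨σ, fun u => ⟨fun i => ?_, fun i => ?_⟩⟩
    · rw [update_eq_const_of_subsingleton, update_eq_const_of_subsingleton]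
      exact congrArg Prod.fst (hσ u)
    · rw [Subsingleton.elim i 0]
      exact iff_of_eq (congrArg Prod.snd (hσ u))
  · rw [substVertices, substVertices, if_neg hk.ne', if_neg hk.ne'] at h₂
    obtain ⟨σ, hσ⟩ := exists_equiv_of_map_univ_eq h₂
    refine ⟨σ, fun u => ⟨fun i => congrFun (hσ u) i, fun i => ?_⟩⟩
    have : Nontrivial (Fin k) := Fin.nontrivial_iff_two_le.2 hk
    obtain ⟨j, hj⟩ := exists_ne i
    have := adj_iff_of_orderedIsoType_eq
      (orderedIsoType_eq_of_wlColor_eq (congrFun (hσ u) j)) i j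
    simpa [hj.symm] using this

/-- For `WL_k`-equivalent graphs, having the same color after sufficiently many rounds is a
bisimulation, and the vertex colors of the two graphs match. -/
theorem WLEquiv.exists_isBisimulation (hk : 1 ≤ k) (h : WLEquiv k G H) :
    ∃ (r : ℕ) (e : V ≃ W),
      IsBisimulation G H k (fun x y => wlColor G k r x = wlColor H k r y) ∧
      ∀ v, wlColor G k r (fun _ => v) = wlColor H k r (fun _ => e v) := by
  obtain ⟨hN, hpal⟩ := Sigma.mk.inj_iff.1 h
  have hcard : Fintype.card V = Fintype.card W :=
    Nat.pow_left_injective (by omega) hN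
  rw [← hN] at hpal
  replace hpal := eq_of_heq hpal
  rcases isEmpty_or_nonempty V with hV | hV
  · have hW : IsEmpty W := Fintype.card_eq_zero_iff.1 (by rw [← hcard, Fintype.card_eq_zero])
    exact ⟨0, Equiv.equivOfIsEmpty V W,
      ⟨fun {x} => isEmptyElim (x ⟨0, hk⟩), fun {x} => isEmptyElim (x ⟨0, hk⟩)⟩, isEmptyElim⟩
  obtain ⟨r, hr, hst⟩ := exists_wlColor_stable G k
  have hpr := map_wlColor_eq_of_le hpal hr.le
  have hbis : IsBisimulation G H k (fun x y => wlColor G k r x = wlColor H k r y) := by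
    refine ⟨fun h => orderedIsoType_eq_of_wlColor_eq h, fun {x y} hxy => ?_⟩
    refine exists_equiv_of_wlColor_succ_eq hk hpr ?_
    -- Stability is known only within `G`, so `y` is replaced by a tuple of `G` with the same color
    -- in round `r + 1`; this round is still covered by the palette because `r < n ^ k`.
    obtain ⟨τ, hτ⟩ := exists_equiv_of_map_univ_eq (map_wlColor_eq_of_le hpal hr)
    have hx' := hτ (τ.symm y)
    rw [Equiv.apply_symm_apply] at hx'
    rw [← hx']
    exact hst _ _ (hxy.trans (congrArg WLColor.prev hx').symm)
  -- Any matched pair of tuples yields a vertex bijection; substituting at slot `0` and reindexing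
  -- by the constant map turns it into a match of constant tuples.
  obtain ⟨τ, hτ⟩ := exists_equiv_of_map_univ_eq hpr
  obtain ⟨x⟩ : Nonempty (Fin k → V) := inferInstance
  obtain ⟨σ, hσ⟩ := hbis.exists_equiv (hτ x)
  refine ⟨r, σ, hbis, fun v => ?_⟩
  have := hbis.wlColor_comp_eq r ((hσ v).1 ⟨0, hk⟩) fun _ => ⟨0, hk⟩
  simpa [Function.comp_def] using this

end Stabilization

/-! ### Sums over assignments along a tree decomposition -/

section Counting

open Classical

variable {V : Type u} {W : Type v} {U : Type w} {G : SimpleGraph V} {H : SimpleGraph W} {k : ℕ}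
  {R : (Fin k → V) → (Fin k → W) → Prop}

/-- On `T`, the assignments `φ` and `ψ` are read off from a pair of tuples related by `R`. -/
def Linked (R : (Fin k → V) → (Fin k → W) → Prop) (T : Finset U) (φ : U → V) (ψ : U → W) : Prop :=
  ∃ x y, R x y ∧ ∀ q ∈ T, ∃ i, x i = φ q ∧ y i = ψ q

/-- The assignments `φ` and `ψ` look alike on the bag `B`: they induce the same adjacencies and are
linked on every set of at most `k` elements of `B`. -/
def BagEquiv (G : SimpleGraph V) (H : SimpleGraph W) (R : (Fin k → V) → (Fin k → W) → Prop)
    (B : Finset U) (φ : U → V) (ψ : U → W) : Prop :=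
  (∀ p ∈ B, ∀ q ∈ B, G.Adj (φ p) (φ q) ↔ H.Adj (ψ p) (ψ q)) ∧
    ∀ T ⊆ B, T.card ≤ k → Linked R T φ ψ

theorem BagEquiv.mono {S B : Finset U} {φ : U → V} {ψ : U → W} (h : BagEquiv G H R B φ ψ)
    (hS : S ⊆ B) : BagEquiv G H R S φ ψ :=
  ⟨fun p hp q hq => h.1 p (hS hp) q (hS hq), fun T hT => h.2 T (hT.trans hS)⟩

theorem BagEquiv.of_update {B : Finset U} {φ : U → V} {ψ : U → W} {u : U} {a : V} {b : W}
    (hu : u ∉ B) (h : BagEquiv G H R B φ ψ) :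
    BagEquiv G H R B (update φ u a) (update ψ u b) := by
  have hne : ∀ q ∈ B, q ≠ u := fun q hq h => hu (h ▸ hq)
  refine ⟨fun p hp q hq => ?_, fun T hT hc => ?_⟩
  · simpa [hne p hp, hne q hq] using h.1 p hp q hq
  · obtain ⟨x, y, hxy, hl⟩ := h.2 T hT hc
    exact ⟨x, y, hxy, fun q hq => by simpa [hne q (hT hq)] using hl q hq⟩

/-- A tuple holds all of `S` but perhaps not `u` as well. Adjacencies to `u` come from the
bisimulation directly; a set `T` of at most `k` elements containing `u` uses at most `k - 1` slots
for the others, which leaves one for `u`. -/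
theorem BagEquiv.exists_equiv (hk : 1 ≤ k) (hR : IsBisimulation G H k R) {S : Finset U} {u : U} (hu : u ∉ S)
    (hS : S.card ≤ k) {φ : U → V} {ψ : U → W} (h : BagEquiv G H R S φ ψ) :
    ∃ σ : V ≃ W, ∀ a, BagEquiv G H R (insert u S) (update φ u a) (update ψ u (σ a)) := by
  obtain ⟨x, y, hxy, hl⟩ := h.2 S Subset.rfl hS
  obtain ⟨σ, hσ⟩ := hR.exists_equiv hxy
  have : Nonempty (Fin k) := ⟨0, hk⟩
  choose! ι hι using hl
  refine ⟨σ, fun a => ⟨fun p hp q hq => ?_, fun T hT hc => ?_⟩⟩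
  · have hadj : ∀ q ∈ S, G.Adj (φ q) a ↔ H.Adj (ψ q) (σ a) := fun q hq => by
      rw [← (hι q hq).1, ← (hι q hq).2]
      exact (hσ a).2 (ι q)
    have hne : ∀ q ∈ S, q ≠ u := fun q hq h => hu (h ▸ hq)
    rw [mem_insert] at hp hq
    rcases hp with rfl | hp <;> rcases hq with rfl | hq
    · simp
    · simpa [hne q hq, SimpleGraph.adj_comm] using hadj q hq
    · simpa [hne p hp] using hadj p hp
    · simpa [hne p hp, hne q hq] using h.1 p hp q hq
  · by_cases huT : u ∈ T
    · have hTS : ∀ q ∈ T, q ≠ u → q ∈ S := fun q hq hqu => mem_of_mem_insert_of_ne (hT hq) hqu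
      have hlt : ((T.erase u).image ι).card < (univ : Finset (Fin k)).card := by
        refine card_image_le.trans_lt ?_
        rw [card_fin]
        exact (card_erase_lt_of_mem huT).trans_le hc
      obtain ⟨m, -, hm⟩ := exists_mem_notMem_of_card_lt_card hlt
      refine ⟨_, _, (hσ a).1 m, fun q hq => ?_⟩
      by_cases hqu : q = u
      · exact ⟨m, by simp [hqu]⟩
      · have hne : ι q ≠ m := fun h => hm (h ▸ mem_image_of_mem _ (by simp [hq, hqu]))
        exact ⟨ι q, by simpa [hne, hqu] using hι q (hTS q hq hqu)⟩
    · refine ⟨x, y, hxy, fun q hq => ?_⟩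
      have hqu : q ≠ u := fun h => huT (h ▸ hq)
      exact ⟨ι q, by simpa [hqu] using hι q (mem_of_mem_insert_of_ne (hT hq) hqu)⟩

variable [Fintype V] [Fintype W] [Fintype U]

/-- Over the assignments sending the root `p` to `v` and to `w` respectively, functions that agree
on pairs of assignments which look alike on all the bags in `𝓑` have the same sum. -/
def SumDetermined (G : SimpleGraph V) (H : SimpleGraph W) (R : (Fin k → V) → (Fin k → W) → Prop)
    (p : U) (v : V) (w : W) (𝓑 : Set (Finset U)) : Prop :=
  ∀ (f : (U → V) → ℕ) (g : (U → W) → ℕ),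
    (∀ φ ψ, φ p = v → ψ p = w → (∀ B ∈ 𝓑, BagEquiv G H R B φ ψ) → f φ = g ψ) →
    ∑ φ with φ p = v, f φ = ∑ ψ with ψ p = w, g ψ

variable {p : U} {v : V} {w : W}

theorem SumDetermined.mono {𝓑 𝓒 : Set (Finset U)} (h : SumDetermined G H R p v w 𝓑)
    (hBC : ∀ C ∈ 𝓒, ∃ B ∈ 𝓑, C ⊆ B) : SumDetermined G H R p v w 𝓒 := by
  refine fun f g hfg => h f g fun φ ψ hφ hψ hall => hfg φ ψ hφ hψ fun C hC => ?_
  obtain ⟨B, hB, hCB⟩ := hBC C hC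
  exact (hall B hB).mono hCB

/-- All rooted pairs look alike on `{p}`, so any bijection sending `v` to `w` matches the terms. -/
theorem sumDetermined_root (e : V ≃ W) (hvw : ∃ x y, R x y ∧ ∃ i, x i = v ∧ y i = w) :
    SumDetermined G H R p v w {{p}} := by
  intro f g hfg
  obtain ⟨x, y, hxy, i, hx, hy⟩ := hvw
  have hgood : ∀ (φ : U → V) (ψ : U → W), φ p = v → ψ p = w → f φ = g ψ := by
    refine fun φ ψ hφ hψ => hfg φ ψ hφ hψ ?_
    rintro B rfl
    refine ⟨by simp, fun T hT _ => ⟨x, y, hxy, fun q hq => ⟨i, ?_⟩⟩⟩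
    obtain rfl := mem_singleton.1 (hT hq)
    exact ⟨hx.trans hφ.symm, hy.trans hψ.symm⟩
  obtain ⟨σ, hσ⟩ : ∃ σ : V ≃ W, σ v = w := ⟨e.trans (Equiv.swap (e v) w), by simp⟩
  refine sum_equiv (Equiv.arrowCongr (Equiv.refl U) σ) (fun φ => ?_) fun φ hφ => ?_
  · simp [← hσ]
  · have hφ : φ p = v := by simpa using hφ
    exact hgood _ _ hφ (by simp [hφ, hσ])

theorem sum_sum_update {X : Type*} [Fintype X] {u p : U} (hup : u ≠ p) (v : X)
    (f : (U → X) → ℕ) :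
    ∑ φ with φ p = v, ∑ a, f (update φ u a) = Fintype.card X * ∑ φ with φ p = v, f φ := by
  have hconst : ∑ φ : U → X with φ p = v, ∑ _a : X, f φ =
      Fintype.card X * ∑ φ with φ p = v, f φ := by
    simp [mul_sum]
  rw [← hconst, ← sum_product', ← sum_product']
  -- Exchanging the value at `u` with the spare value is an involution.
  refine sum_nbij' (fun z => (update z.1 u z.2, z.1 u)) (fun z => (update z.1 u z.2, z.1 u))
    ?_ ?_ ?_ ?_ ?_ <;> simp +contextual [hup.symm]

/-- Resampling the value at `u` leaves the bags in `𝓑` undisturbed and multiplies both sums by the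
same number `|V| = |W|`, which cancels. -/
theorem SumDetermined.insert_vertex (hk : 1 ≤ k) (hR : IsBisimulation G H k R) (e : V ≃ W)
    {𝓑 : Set (Finset U)} {S : Finset U} {u : U} (hup : u ≠ p) (hu : ∀ B ∈ 𝓑, u ∉ B)
    (hS : ∃ B ∈ 𝓑, S ⊆ B) (hc : S.card ≤ k) (h : SumDetermined G H R p v w 𝓑) :
    SumDetermined G H R p v w (insert (insert u S) 𝓑) := by
  obtain ⟨B, hB, hSB⟩ := hS
  intro f g hfg
  have key := h (fun φ => ∑ a, f (update φ u a)) (fun ψ => ∑ b, g (update ψ u b)) ?_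
  · rw [sum_sum_update hup, sum_sum_update hup] at key
    rw [← Fintype.card_congr e] at key
    exact Nat.eq_of_mul_eq_mul_left (Fintype.card_pos_iff.2 ⟨v⟩) key
  · intro φ ψ hφ hψ hall
    obtain ⟨σ, hσ⟩ := BagEquiv.exists_equiv hk hR (fun h => hu B hB (hSB h)) hc
      ((hall B hB).mono hSB)
    refine Fintype.sum_equiv σ _ _ fun a => hfg _ _ (by simp [hup.symm, hφ])
      (by simp [hup.symm, hψ]) ?_
    rintro C (rfl | hC)
    · exact hσ a
    · exact (hall C hC).of_update (hu C hC)

theorem SumDetermined.insert_bag (hk : 1 ≤ k) (hR : IsBisimulation G H k R) (e : V ≃ W)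
    {𝓑 : Set (Finset U)} {S N : Finset U} (hp : p ∉ N) (hN : ∀ B ∈ 𝓑, ∀ u ∈ N, u ∉ B)
    (hS : ∃ B ∈ 𝓑, S ⊆ B) (hc : (S ∪ N).card ≤ k + 1) (h : SumDetermined G H R p v w 𝓑) :
    SumDetermined G H R p v w (insert (S ∪ N) 𝓑) := by
  obtain ⟨B, hB, hSB⟩ := hS
  induction N using Finset.induction_on with
  | empty =>
    refine h.mono ?_
    rintro C (rfl | hC)
    · exact ⟨B, hB, by simpa⟩
    · exact ⟨C, hC, Subset.rfl⟩
  | insert u N hu ih =>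
    have huS : u ∉ S := fun h => hN B hB u (mem_insert_self _ _) (hSB h)
    have hcard : (S ∪ N).card + 1 ≤ k + 1 := by
      rw [← card_insert_of_notMem (a := u) (by simp [huS, hu]), ← union_insert]
      exact hc
    have h' := (ih (fun h => hp (mem_insert_of_mem h))
      (fun B hB u hu => hN B hB u (mem_insert_of_mem hu)) (by omega)).insert_vertex hk hR e
      (S := S ∪ N) (u := u) (fun h => hp (by simp [h])) ?_ ⟨_, Set.mem_insert _ _, Subset.rfl⟩
      (by omega)
    · refine h'.mono ?_
      rintro C (rfl | hC)
      · exact ⟨_, Set.mem_insert _ _, by rw [union_insert]⟩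
      · exact ⟨C, Set.mem_insert_of_mem _ (Set.mem_insert_of_mem _ hC), Subset.rfl⟩
    · rintro C (rfl | hC)
      · simp [huS, hu]
      · exact hN C hC u (mem_insert_self _ _)

/-- The bags of a tree decomposition of width at most `k` determine sums: the vertices are
introduced one after another, starting in a bag containing the root. -/
theorem sumDetermined_range_bag (hk : 1 ≤ k) (hR : IsBisimulation G H k R) (e : V ≃ W)
    (hvw : ∃ x y, R x y ∧ ∃ i, x i = v ∧ y i = w) (n : ℕ) :
    ∀ {node : Type} [Finite node] {T : SimpleGraph node} (_ : T.IsTree) (bag : node → Finset U)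
      (_ : ∀ t, (bag t).card ≤ k + 1)
      (_ : ∀ {s t} (P : T.Walk s t), P.IsPath → ∀ r ∈ P.support, bag s ∩ bag t ⊆ bag r)
      (t₀ : node) (_ : p ∈ bag t₀) (_ : Nat.card node = n),
      SumDetermined G H R p v w (Set.range bag) := by
  induction n with
  | zero =>
    intro node _ T _ bag _ _ t₀ _ hn
    have : Nonempty node := ⟨t₀⟩
    exact absurd hn Nat.card_pos.ne'
  | succ n ih =>
    intro node _ T hT bag hcard hconv t₀ hp hn
    rcases subsingleton_or_nontrivial node with hs | hs
    · have h := (sumDetermined_root (G := G) (H := H) (R := R) (p := p) e hvw).insert_bag hk hR e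
        (S := {p}) (N := bag t₀ \ {p}) ?_ ?_ ⟨{p}, Set.mem_singleton _, Subset.rfl⟩ ?_
      · refine h.mono ?_
        rintro _ ⟨t, rfl⟩
        refine ⟨_, Set.mem_insert _ _, ?_⟩
        rw [Subsingleton.elim t t₀]
        intro q hq
        by_cases hqp : q = p <;> simp [hq, hqp]
      · simp
      · rintro _ rfl u hu
        exact (mem_sdiff.1 hu).2
      · rw [union_sdiff_of_subset (by simpa using hp)]
        exact hcard t₀
    have := Fintype.ofFinite node
    -- A leaf other than the root bag is removed; a nontrivial tree has two leaves.
    obtain ⟨t, ht₀, ht⟩ : ∃ t ≠ t₀, T.degree t = 1 := by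
      obtain ⟨a, b, hab, ha, hb⟩ := hT.exists_ne_and_degree_eq_one
      by_cases h : a = t₀
      · exact ⟨b, fun hb => hab (h.trans hb.symm), hb⟩
      · exact ⟨a, h, ha⟩
    obtain ⟨t', htt', huniq⟩ := SimpleGraph.degree_eq_one_iff_existsUnique_adj.1 ht
    have hT' : (T.induce {t}ᶜ).IsTree :=
      ⟨hT.connected.induce_compl_singleton_of_degree_eq_one ht, hT.isAcyclic.induce _⟩
    -- Every path leaving `t` passes through `t'`. Hence `bag t \ bag t'` meets no other bag and
    -- does not contain `p`.
    have hnbr : ∀ s ≠ t, bag t ∩ bag s ⊆ bag t' := by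
      intro s hst
      obtain ⟨P, hP⟩ := hT.connected.exists_isPath t s
      have hnil : ¬ P.Nil := fun h => hst h.eq.symm
      rw [← huniq _ (P.adj_snd hnil)]
      exact hconv P hP _ (P.getVert_mem_support 1)
    have h := ih hT' (fun s => bag s) (fun s => hcard s) ?_ ⟨t₀, ht₀.symm⟩ hp ?_
    · have h' := h.insert_bag hk hR e (S := bag t ∩ bag t') (N := bag t \ bag t') ?_ ?_ ?_ ?_
      · refine h'.mono ?_
        rintro _ ⟨s, rfl⟩
        by_cases hst : s = t
        · refine ⟨_, Set.mem_insert _ _, ?_⟩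
          rw [hst, union_comm, sdiff_union_inter]
        · exact ⟨bag s, Set.mem_insert_of_mem _ ⟨⟨s, hst⟩, rfl⟩, Subset.rfl⟩
      · intro hpN
        rw [mem_sdiff] at hpN
        exact hpN.2 (hnbr t₀ ht₀.symm (mem_inter.2 ⟨hpN.1, hp⟩))
      · rintro _ ⟨s, rfl⟩ u hu hus
        rw [mem_sdiff] at hu
        exact hu.2 (hnbr s s.2 (mem_inter.2 ⟨hu.1, hus⟩))
      · exact ⟨bag t', ⟨⟨t', htt'.ne'⟩, rfl⟩, inter_subset_right⟩
      · rw [union_comm, sdiff_union_inter]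
        exact hcard t
    · intro s s' P hP r hr
      refine hconv (P.map (SimpleGraph.Embedding.induce {t}ᶜ).toHom)
        (hP.map Subtype.val_injective) r ?_
      rw [SimpleGraph.Walk.support_map]
      exact List.mem_map_of_mem hr
    · rw [Nat.card_eq_fintype_card, Fintype.card_compl_set, ← Nat.card_eq_fintype_card, hn]
      simp

/-- The nodes whose bags contain `q` induce a connected subgraph, and the path between `s` and `t`
inside it is `P` since paths in a tree are unique. -/
theorem TreeDecomposition.inter_bag_subset {U : Type w} {F : SimpleGraph U}
    (D : TreeDecomposition F) {s t : D.node} (P : D.tree.Walk s t) (hP : P.IsPath) {r : D.node}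
    (hr : r ∈ P.support) : D.bag s ∩ D.bag t ⊆ D.bag r := by
  rintro q ⟨hs, ht⟩
  obtain ⟨Q, hQ⟩ := (D.preconnected q ⟨s, hs⟩ ⟨t, ht⟩).exists_isPath
  have hQ' := hQ.map (f := (SimpleGraph.Embedding.induce {t | q ∈ D.bag t}).toHom)
    Subtype.val_injective
  have heq : P = Q.map (SimpleGraph.Embedding.induce {t | q ∈ D.bag t}).toHom :=
    (D.isTree.existsUnique_path s t).unique hP hQ'
  have hsup := SimpleGraph.Walk.support_map
    (SimpleGraph.Embedding.induce (G := D.tree) {t | q ∈ D.bag t}).toHom Q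
  subst heq
  obtain ⟨r', -, rfl⟩ := List.mem_map.1 ((congrArg (r ∈ ·) hsup).mp hr)
  exact r'.2

theorem exists_treeDecomposition_encard_le {U : Type w} {F : SimpleGraph U}
    (h : treewidth F ≤ (k : ℕ∞)) : ∃ D : TreeDecomposition F, ∀ t, (D.bag t).encard ≤ k + 1 := by
  have hlt : treewidth F < ((k + 1 : ℕ) : ℕ∞) :=
    h.trans_lt (by exact_mod_cast Nat.lt_succ_self k)
  obtain ⟨D, hD⟩ := iInf_lt_iff.1 hlt
  refine ⟨D, fun t => (le_iSup (fun t => (D.bag t).encard) t).trans ?_⟩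
  have : D.width ≤ k := by
    rw [Nat.cast_add, Nat.cast_one] at hD
    exact Order.le_of_lt_add_one hD
  exact tsub_le_iff_right.1 this

/-- Let `F` have treewidth at most `k`. Functions of assignments from the vertices of `F` which only
depend on the adjacencies along the edges of `F` and on the linkedness of single vertices have the
same sum over the assignments with a fixed image of the root. -/
theorem sum_eq_of_treewidth_le (hk : 1 ≤ k) (hR : IsBisimulation G H k R) (e : V ≃ W)
    (hvw : ∃ x y, R x y ∧ ∃ i, x i = v ∧ y i = w) {F : SimpleGraph U}
    (hF : treewidth F ≤ (k : ℕ∞)) (f : (U → V) → ℕ) (g : (U → W) → ℕ)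
    (hfg : ∀ φ ψ, (∀ a b, F.Adj a b → (G.Adj (φ a) (φ b) ↔ H.Adj (ψ a) (ψ b))) →
      (∀ q, ∃ x y, R x y ∧ ∃ i, x i = φ q ∧ y i = ψ q) → f φ = g ψ) :
    ∑ φ with φ p = v, f φ = ∑ ψ with ψ p = w, g ψ := by
  obtain ⟨D, hD⟩ := exists_treeDecomposition_encard_le hF
  have := D.finite_node
  obtain ⟨t₀, ht₀⟩ := D.exists_mem_bag p
  have h := sumDetermined_range_bag (G := G) (H := H) (p := p) hk hR e hvw _ D.isTree
    (fun t => (D.bag t).toFinset) (fun t => ?_) (fun P hP r hr => ?_) t₀ (by simpa) rfl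
  · refine h f g fun φ ψ _ _ hall => hfg φ ψ (fun a b hab => ?_) fun q => ?_
    · obtain ⟨t, ha, hb⟩ := D.exists_adj_mem_bag a b hab
      exact (hall _ ⟨t, rfl⟩).1 a (by simpa) b (by simpa)
    · obtain ⟨t, ht⟩ := D.exists_mem_bag q
      obtain ⟨x, y, hxy, hl⟩ := (hall _ ⟨t, rfl⟩).2 {q} (by simpa) (by simpa)
      exact ⟨x, y, hxy, hl q (mem_singleton_self q)⟩
  · have := hD t
    rw [← Set.coe_toFinset (D.bag t), Set.encard_coe_eq_coe_finsetCard] at this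
    exact_mod_cast this
  · rw [← Set.toFinset_inter]
    exact Set.toFinset_subset_toFinset.2 (D.inter_bag_subset P hP hr)

end Counting

/-! ### From homomorphisms to injective homomorphisms -/

section InjectiveHoms

open Classical

variable {V : Type u} {W : Type v} {U : Type w} {G : SimpleGraph V} {H : SimpleGraph W} {k : ℕ}
  {R : (Fin k → V) → (Fin k → W) → Prop} {Γ : Type*}

/-- `φ` is a homomorphism from `F` to `G` that maps every vertex `q` to a vertex of color `δ q`. -/
def IsColoredHom (F : SimpleGraph U) (G : SimpleGraph V) (c : V → Γ) (δ : U → Γ) (φ : U → V) :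
    Prop :=
  (∀ a b, F.Adj a b → G.Adj (φ a) (φ b)) ∧ ∀ q, c (φ q) = δ q

/-- A colored homomorphism that maps the vertex `p` to `v`. -/
def IsRootedHom (F : SimpleGraph U) (G : SimpleGraph V) (c : V → Γ) (δ : U → Γ) (p : U) (v : V)
    (φ : U → V) : Prop :=
  φ p = v ∧ IsColoredHom F G c δ φ

/-- The quotient of a graph by an equivalence relation of its vertices. -/
def quotientGraph (F : SimpleGraph U) (θ : Setoid U) : SimpleGraph (Quotient θ) :=
  SimpleGraph.fromRel fun x y => ∃ a b, F.Adj a b ∧ Quotient.mk θ a = x ∧ Quotient.mk θ b = y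

theorem quotientGraph_adj_mk {F : SimpleGraph U} {θ : Setoid U}
    (hθ : ∀ a b, F.Adj a b → ¬ θ a b) {a b : U} (hab : F.Adj a b) :
    (quotientGraph F θ).Adj (Quotient.mk θ a) (Quotient.mk θ b) :=
  ⟨fun h => hθ a b hab (Quotient.exact h), Or.inl ⟨a, b, hab, rfl, rfl⟩⟩

theorem isHomImage_quotientGraph {F : SimpleGraph U} {θ : Setoid U}
    (hθ : ∀ a b, F.Adj a b → ¬ θ a b) : IsHomImage F (quotientGraph F θ) := by
  refine ⟨⟨Quotient.mk θ, quotientGraph_adj_mk hθ⟩, Quotient.mk_surjective, ?_⟩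
  rintro ⟨e, he⟩
  induction e with
  | h x y =>
    obtain ⟨a, b, hab, rfl, rfl⟩ : ∃ a b, F.Adj a b ∧ Quotient.mk θ a = x ∧ Quotient.mk θ b = y :=
      he.2.elim id fun ⟨a, b, hab, ha, hb⟩ => ⟨b, a, hab.symm, hb, ha⟩
    exact ⟨⟨s(a, b), hab⟩, rfl⟩

theorem treewidth_le_of_isHomImage {F : SimpleGraph U} (hF : htw F ≤ (k : ℕ∞)) {U' : Type w}
    {F' : SimpleGraph U'} (h : IsHomImage F F') : treewidth F' ≤ (k : ℕ∞) :=
  le_trans (le_sSup (Exists.intro U' (Exists.intro F' ⟨h, rfl⟩))) hF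

variable [Fintype V] [Fintype W] [Fintype U]

theorem card_filter_le_ker {X : Type*} [Fintype X] (θ : Setoid U) (P : (U → X) → Prop) :
    #{φ : U → X | P φ ∧ θ ≤ Setoid.ker φ} =
      #{φ : Quotient θ → X | P (φ ∘ Quotient.mk θ)} := by
  symm
  refine card_nbij (fun φ => φ ∘ Quotient.mk θ) (fun φ hφ => ?_) (fun φ _ φ' _ h => ?_)
    fun φ hφ => ?_
  · simp only [coe_filter, mem_univ, true_and, Set.mem_ofPred_eq] at hφ ⊢
    exact ⟨hφ, fun a b hab => congrArg φ (Quotient.sound hab)⟩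
  · exact Quotient.mk_surjective.injective_comp_right h
  · simp only [coe_filter, mem_univ, true_and, Set.mem_ofPred_eq] at hφ
    exact ⟨Quotient.lift φ fun a b hab => hφ.2 hab, by simpa [Function.comp_def] using hφ.1, rfl⟩

/-- This triangular system lets counts by exact kernel be recovered from counts by a lower bound on
the kernel. -/
theorem card_filter_le_ker_eq_add {X : Type*} [Fintype X] [Fintype (Setoid U)] (θ : Setoid U)
    (P : (U → X) → Prop) :
    #{φ : U → X | P φ ∧ θ ≤ Setoid.ker φ} = #{φ : U → X | P φ ∧ Setoid.ker φ = θ} +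
      ∑ θ' with θ < θ', #{φ : U → X | P φ ∧ Setoid.ker φ = θ'} := by
  have hmaps : ∀ φ ∈ ({φ : U → X | P φ ∧ θ ≤ Setoid.ker φ} : Finset (U → X)),
      Setoid.ker φ ∈ insert θ ({θ' | θ < θ'} : Finset (Setoid U)) := fun φ hφ => by
    simpa [le_iff_eq_or_lt, eq_comm] using (mem_filter.1 hφ).2.2
  rw [card_eq_sum_card_fiberwise hmaps, sum_insert (by simp)]
  congr 1
  · rw [filter_filter]
    refine congrArg card (filter_congr fun φ _ => ?_)
    exact ⟨fun h => ⟨h.1.1, h.2⟩, fun h => ⟨⟨h.1, h.2.ge⟩, h.2⟩⟩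
  · refine sum_congr rfl fun θ' hθ' => ?_
    rw [filter_filter]
    refine congrArg card (filter_congr fun φ _ => ?_)
    exact ⟨fun h => ⟨h.1.1, h.2⟩, fun h => ⟨⟨h.1, h.2 ▸ (mem_filter.1 hθ').2.le⟩, h.2⟩⟩

/-- The number of injective colored homomorphisms with a fixed image of the root. -/
theorem card_injective_isColoredHom_eq (hk : 1 ≤ k) (hR : IsBisimulation G H k R) (e : V ≃ W)
    {c : V → Γ} {d : W → Γ} (hcd : ∀ x y, R x y → ∀ i, c (x i) = d (y i))
    {F : SimpleGraph U} (hF : htw F ≤ (k : ℕ∞)) (δ : U → Γ) (p : U) {v : V} {w : W}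
    (hvw : ∃ x y, R x y ∧ ∃ i, x i = v ∧ y i = w) :
    #{φ : U → V | IsRootedHom F G c δ p v φ ∧ Injective φ} =
      #{ψ : U → W | IsRootedHom F H d δ p w ψ ∧ Injective ψ} := by
  have hle : ∀ θ : Setoid U,
      #{φ : U → V | IsRootedHom F G c δ p v φ ∧ θ ≤ Setoid.ker φ} =
        #{ψ : U → W | IsRootedHom F H d δ p w ψ ∧ θ ≤ Setoid.ker ψ} := by
    intro θ
    by_cases hθ : ∀ a b, F.Adj a b → ¬ θ a b
    · have h := sum_eq_of_treewidth_le (p := Quotient.mk θ p) hk hR e hvw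
        (treewidth_le_of_isHomImage hF (isHomImage_quotientGraph hθ))
        (fun φ => if IsColoredHom F G c δ (φ ∘ Quotient.mk θ) then 1 else 0)
        (fun ψ => if IsColoredHom F H d δ (ψ ∘ Quotient.mk θ) then 1 else 0) ?_
      · rw [card_filter_le_ker, card_filter_le_ker]
        simp only [sum_boole, filter_filter, Nat.cast_id] at h
        convert h using 2 <;>
          · ext φ
            rw [mem_filter, mem_filter]
            simp [IsRootedHom]
      · intro φ ψ hadj hlink
        have hiff : IsColoredHom F G c δ (φ ∘ Quotient.mk θ) ↔
            IsColoredHom F H d δ (ψ ∘ Quotient.mk θ) := by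
          refine and_congr (forall₂_congr fun a b => forall_congr' fun hab =>
            hadj _ _ (quotientGraph_adj_mk hθ hab)) (forall_congr' fun q => ?_)
          obtain ⟨x, y, hxy, i, hx, hy⟩ := hlink (Quotient.mk θ q)
          rw [comp_apply, comp_apply, ← hx, ← hy, hcd x y hxy i]
        simp only [hiff]
    -- A partition merging two adjacent vertices lies below the kernel of no homomorphism: the
    -- target has no loops.
    · push Not at hθ
      obtain ⟨a, b, hab, hθ⟩ := hθ
      rw [filter_false_of_mem (fun φ _ h => (h.1.2.1 a b hab).ne (h.2 hθ)),
        filter_false_of_mem (fun φ _ h => (h.1.2.1 a b hab).ne (h.2 hθ))]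
      rfl
  have : Finite (Setoid U) :=
    Finite.of_injective (fun θ : Setoid U => fun a b => θ a b) fun θ θ' h =>
      Setoid.ext fun a b => iff_of_eq (congrFun (congrFun h a) b)
  have : Fintype (Setoid U) := Fintype.ofFinite _
  -- Induction from the coarsest partition downwards; injectivity is the case `θ = ⊥`.
  have heq : ∀ θ : Setoid U,
      #{φ : U → V | IsRootedHom F G c δ p v φ ∧ Setoid.ker φ = θ} =
        #{ψ : U → W | IsRootedHom F H d δ p w ψ ∧ Setoid.ker ψ = θ} := by
    intro θ
    induction θ using WellFoundedGT.induction with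
    | ind θ ih =>
      have h := hle θ
      rw [card_filter_le_ker_eq_add, card_filter_le_ker_eq_add,
        sum_congr rfl fun θ' hθ' => ih θ' (mem_filter.1 hθ').2] at h
      exact Nat.add_right_cancel h
  simpa only [Setoid.injective_iff_ker_bot] using heq ⊥

end InjectiveHoms

/-! ### Transfer of fractional matchings -/

section LinearProgram

open Classical

variable {V : Type u} {W : Type v} {U : Type w} {Γ : Type*} [Fintype V] [Fintype W] [Fintype U]

/-- Transfer of fractional matchings between hypergraphs whose hyperedges are ranges of
assignments: if every vertex of a color class lies in the same number of the assignments in `B` of a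
given color pattern, then the weight of a hyperedge of `S` can be spread evenly over the
assignments in `B` with the same color pattern. -/
theorem fracMatchingNumber_le_of_colored {S : Finset (Finset V)} {S' : Finset (Finset W)}
    {c : V → Γ} {d : W → Γ} (σ : V ≃ W) (hσ : ∀ v, c v = d (σ v)) (φ : S → U → V)
    (hφ : ∀ e, Injective (φ e)) (himg : ∀ e, univ.image (φ e) = e.1) (B : Finset (U → W))
    (hB : ∀ ψ ∈ B, univ.image ψ ∈ S')
    (hdeg : ∀ (δ : U → Γ) (q : U) (w w' : W), d w = d w' →
      #{ψ ∈ B | d ∘ ψ = δ ∧ ψ q = w} = #{ψ ∈ B | d ∘ ψ = δ ∧ ψ q = w'})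
    (hne : ∀ e, ∃ ψ ∈ B, d ∘ ψ = c ∘ φ e) :
    fracMatchingNumber S ≤ fracMatchingNumber S' := by
  let D : (U → Γ) → Finset (U → W) := fun δ => {ψ ∈ B | d ∘ ψ = δ}
  let C : W → Finset W := fun w => {w' | d w' = d w}
  have hC : ∀ w, (0 : ℝ) < #(C w) := fun w => by
    exact_mod_cast card_pos.2 ⟨w, by simp [C]⟩
  have hD : ∀ e, (0 : ℝ) < #(D (c ∘ φ e)) := fun e => by
    obtain ⟨ψ, hψ, h⟩ := hne e
    exact_mod_cast card_pos.2 ⟨ψ, by simp [D, hψ, h]⟩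
  -- The assignments of pattern `δ` with `ψ q = w'`, for `w'` in the class of `w`, are disjoint
  -- families of equal size inside `D δ`; there are none unless `δ q` is the color of `w`.
  have hratio : ∀ (δ : U → Γ) (q : U) (w : W),
      #{ψ ∈ B | d ∘ ψ = δ ∧ ψ q = w} * #(C w) ≤ if δ q = d w then #(D δ) else 0 := by
    intro δ q w
    split_ifs with h
    · rw [mul_comm, ← smul_eq_mul, ← sum_const, sum_congr rfl fun w' hw' =>
        hdeg δ q w w' (mem_filter.1 hw').2.symm, ← card_biUnion]
      · refine card_le_card fun ψ hψ => ?_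
        simp only [mem_biUnion, mem_filter] at hψ
        obtain ⟨w', -, hψB, hψ, -⟩ := hψ
        exact mem_filter.2 ⟨hψB, hψ⟩
      · intro a _ b _ hab
        refine disjoint_left.2 fun ψ ha hb => hab ?_
        exact (mem_filter.1 ha).2.2.symm.trans (mem_filter.1 hb).2.2
    · rw [filter_false_of_mem, card_empty, zero_mul]
      rintro ψ - ⟨rfl, rfl⟩
      exact h rfl
  have hcover : ∀ (e : S) (w : W), (#{ψ ∈ D (c ∘ φ e) | w ∈ univ.image ψ} : ℝ) * #(C w) ≤
      #{v ∈ e.1 | c v = d w} * #(D (c ∘ φ e)) := by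
    intro e w
    have h₁ : #{ψ ∈ D (c ∘ φ e) | w ∈ univ.image ψ} ≤
        ∑ q : U, #{ψ ∈ B | d ∘ ψ = c ∘ φ e ∧ ψ q = w} := by
      refine (card_le_card fun ψ hψ => ?_).trans card_biUnion_le
      simp only [D, mem_filter, mem_image, mem_univ, true_and] at hψ
      obtain ⟨⟨hψB, hψ⟩, q, hq⟩ := hψ
      exact mem_biUnion.2 ⟨q, mem_univ _, mem_filter.2 ⟨hψB, hψ, hq⟩⟩
    have h₂ : #{v ∈ e.1 | c v = d w} = #{q : U | c (φ e q) = d w} := by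
      rw [← himg e, filter_image, card_image_of_injective _ (hφ e)]
    have h₃ : #{ψ ∈ D (c ∘ φ e) | w ∈ univ.image ψ} * #(C w) ≤
        #{v ∈ e.1 | c v = d w} * #(D (c ∘ φ e)) := by
      calc _ ≤ (∑ q : U, #{ψ ∈ B | d ∘ ψ = c ∘ φ e ∧ ψ q = w}) * #(C w) :=
            Nat.mul_le_mul_right _ h₁
        _ = ∑ q : U, #{ψ ∈ B | d ∘ ψ = c ∘ φ e ∧ ψ q = w} * #(C w) := sum_mul _ _ _
        _ ≤ ∑ q : U, if c (φ e q) = d w then #(D (c ∘ φ e)) else 0 :=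
            sum_le_sum fun q _ => hratio _ q w
        _ = _ := by rw [← sum_filter, sum_const, smul_eq_mul, h₂]
    exact_mod_cast h₃
  refine iSup₂_le fun x hx => ?_
  let y : (U → W) → ℝ := fun ψ =>
    ∑ e, if d ∘ ψ = c ∘ φ e then x e / #(D (c ∘ φ e)) else 0
  have hy : ∀ ψ, 0 ≤ y ψ := fun ψ => sum_nonneg fun e _ => by
    split_ifs
    · exact div_nonneg (hx.1 e) (hD e).le
    · exact le_rfl
  have hysum : ∀ P : (U → W) → Prop, ∑ ψ ∈ B with P ψ, y ψ =
      ∑ e, x e / #(D (c ∘ φ e)) * #{ψ ∈ D (c ∘ φ e) | P ψ} := by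
    intro P
    rw [sum_comm]
    refine sum_congr rfl fun e _ => ?_
    rw [← sum_filter, sum_const, nsmul_eq_mul, mul_comm, filter_filter, filter_filter]
    simp only [and_comm]
  -- Several assignments may have the same range, so their weights are collected on the hyperedge.
  let x' : S' → ℝ := fun e' => ∑ ψ ∈ B with univ.image ψ = e'.1, y ψ
  have hfiber : ∀ P : Finset W → Prop, ∑ e' : S' with P e'.1, x' e' =
      ∑ ψ ∈ B with P (univ.image ψ), y ψ := by
    intro P
    have hmaps : ∀ ψ ∈ {ψ ∈ B | P (univ.image ψ)}, univ.image ψ ∈ {e' ∈ S' | P e'} :=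
      fun ψ hψ => mem_filter.2 ⟨hB ψ (mem_filter.1 hψ).1, (mem_filter.1 hψ).2⟩
    rw [← sum_fiberwise_of_maps_to hmaps, sum_filter, sum_filter, ← sum_coe_sort S']
    refine sum_congr rfl fun e' _ => ?_
    split_ifs with h
    · rw [filter_filter]
      refine sum_congr (filter_congr fun ψ _ => ?_) fun _ _ => rfl
      exact ⟨fun he => ⟨he ▸ h, he⟩, And.right⟩
    · rfl
  refine le_iSup₂_of_le x' ⟨fun e' => sum_nonneg fun ψ _ => hy ψ, fun w => ?_⟩ ?_
  · have hw : ∑ e' : S' with w ∈ e'.1, x' e' =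
        ∑ e, x e / #(D (c ∘ φ e)) * #{ψ ∈ D (c ∘ φ e) | w ∈ univ.image ψ} := by
      convert (hfiber fun e' => w ∈ e').trans (hysum _)
    rw [hw]
    refine le_of_mul_le_mul_right ?_ (hC w)
    have hcls : #{v | c v = d w} = #(C w) := by
      refine card_equiv σ fun v => ?_
      simp [C, hσ]
    -- Scaled by the class size, the load on `w` is bounded by the total load on its color class in
    -- `G`, which has the same size.
    calc _ = ∑ e, x e / #(D (c ∘ φ e)) * (#{ψ ∈ D (c ∘ φ e) | w ∈ univ.image ψ} * #(C w)) := by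
          rw [sum_mul]; simp only [mul_assoc]
      _ ≤ ∑ e, x e / #(D (c ∘ φ e)) * (#{v ∈ e.1 | c v = d w} * #(D (c ∘ φ e))) :=
          sum_le_sum fun e _ => mul_le_mul_of_nonneg_left (hcover e w)
            (div_nonneg (hx.1 e) (hD e).le)
      _ = ∑ e, ∑ v with c v = d w, if v ∈ e.1 then x e else 0 := by
          refine sum_congr rfl fun e _ => ?_
          have := (hD e).ne'
          rw [← sum_filter, sum_const, nsmul_eq_mul, filter_filter]
          have hf : ({v | c v = d w ∧ v ∈ e.1} : Finset V) = {v ∈ e.1 | c v = d w} := by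
            ext v; simp [and_comm]
          rw [hf]
          field_simp
      _ = ∑ v with c v = d w, ∑ e with v ∈ e.1, x e := by
          rw [sum_comm]; simp only [sum_filter]
      _ ≤ ∑ v with c v = d w, 1 := sum_le_sum fun v _ => hx.2 v
      _ = 1 * #(C w) := by rw [sum_const, hcls]; simp
  · have h := hfiber fun _ => True
    rw [hysum] at h
    simp only [filter_true] at h
    rw [h]
    refine le_of_eq (congrArg _ (sum_congr rfl fun e _ => ?_))
    rw [div_mul_cancel₀ _ (hD e).ne']

end LinearProgram

/-! ### Proof of the theorem -/

section Main

open Classical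

variable {V : Type u} {W : Type v} {U : Type w} [Fintype V] [Fintype W] {F : SimpleGraph U}
  {G : SimpleGraph V} {H : SimpleGraph W} {k : ℕ}

theorem mem_packingHypergraph_iff [Fintype U] (e : Finset V) :
    e ∈ packingHypergraph F G ↔ ∃ φ : F.Copy G, univ.image φ = e := by
  rw [packingHypergraph, mem_filter]
  constructor
  · rintro ⟨-, S, ⟨i⟩, hS⟩
    refine ⟨⟨S.hom.comp i.symm.toHom, S.hom_injective.comp i.symm.injective⟩, ?_⟩
    apply coe_injective
    rw [← hS, coe_image, coe_univ, Set.image_univ]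
    ext v
    constructor
    · rintro ⟨q, rfl⟩
      exact (i.symm q).2
    · intro hv
      exact ⟨i ⟨v, hv⟩, congrArg Subtype.val (i.symm_apply_apply ⟨v, hv⟩)⟩
  · rintro ⟨φ, rfl⟩
    exact ⟨mem_univ _, φ.toSubgraph, ⟨φ.isoToSubgraph.symm⟩, by simp [SimpleGraph.Copy.toSubgraph]⟩

theorem WLEquiv.fracPackingNumber_le [Finite U] (hk : 1 ≤ k) (hF : htw F ≤ (k : ℕ∞))
    (hGH : WLEquiv k G H) : fracPackingNumber F G ≤ fracPackingNumber F H := by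
  have := Fintype.ofFinite U
  obtain ⟨r, σ, hR, hσ⟩ := hGH.exists_isBisimulation hk
  have hcd : ∀ (x : Fin k → V) (y : Fin k → W), wlColor G k r x = wlColor H k r y →
      ∀ i, wlColor G k r (fun _ => x i) = wlColor H k r (fun _ => y i) :=
    fun x y hxy i => hR.wlColor_comp_eq r hxy fun _ => i
  have hcount := fun (δ : U → WLColor k r) (q : U) (v : V) (w : W)
    (h : wlColor G k r (fun _ => v) = wlColor H k r (fun _ => w)) =>
    card_injective_isColoredHom_eq hk hR σ
      (c := fun v => wlColor G k r fun _ => v) (d := fun w => wlColor H k r fun _ => w) hcd hF δ q ⟨_, _, h, ⟨0, hk⟩, rfl, rfl⟩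
  choose φ hφ using fun e : packingHypergraph F G => (mem_packingHypergraph_iff e.1).1 e.2
  let B : Finset (U → W) := {ψ | (∀ a b, F.Adj a b → H.Adj (ψ a) (ψ b)) ∧ Injective ψ}
  have hfilter : ∀ (δ : U → WLColor k r) (q : U) (w : W),
      #{ψ ∈ B | (fun w => wlColor H k r fun _ => w) ∘ ψ = δ ∧ ψ q = w} =
      #{ψ : U → W |
        IsRootedHom F H (fun w => wlColor H k r fun _ => w) δ q w ψ ∧ Injective ψ} := by
    intro δ q w
    congr 1
    ext ψ
    rw [mem_filter, mem_filter, mem_filter]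
    simp only [mem_univ, true_and, IsRootedHom, IsColoredHom, funext_iff, comp_apply]
    tauto
  refine fracMatchingNumber_le_of_colored (c := fun v => wlColor G k r fun _ => v)
    (d := fun w => wlColor H k r fun _ => w) σ hσ (fun e => φ e) (fun e => (φ e).injective) hφ B ?_ ?_ ?_
  · intro ψ hψ
    obtain ⟨hadj, hinj⟩ := (mem_filter.1 hψ).2
    exact (mem_packingHypergraph_iff _).2 ⟨⟨⟨ψ, hadj _ _⟩, hinj⟩, rfl⟩
  · intro δ q w w' h
    rw [hfilter, hfilter]
    -- The counts at `w` and `w'` are both compared with the count at one vertex of `G`.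
    have hv : wlColor G k r (fun _ => σ.symm w) = wlColor H k r (fun _ => w) := by
      rw [hσ, σ.apply_symm_apply]
    rw [← hcount δ q (σ.symm w) w hv, ← hcount δ q (σ.symm w) w' (hv.trans h)]
  · intro e
    -- Rooted counts need a root, so empty `U` is separate. Otherwise `φ e` makes the count in `G`
    -- positive, hence also the count in `H`.
    rcases isEmpty_or_nonempty U with hU | ⟨⟨q⟩⟩
    · exact ⟨isEmptyElim, mem_filter.2 ⟨mem_univ _, isEmptyElim, injective_of_subsingleton _⟩,
        Subsingleton.elim _ _⟩
    · have h := hcount (fun u => wlColor G k r fun _ => φ e u) q (φ e q) (σ (φ e q)) (hσ _)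
      have hpos : 0 < #{φ' : U → V | IsRootedHom F G (fun v => wlColor G k r fun _ => v)
          (fun u => wlColor G k r fun _ => φ e u) q (φ e q) φ' ∧ Injective φ'} :=
        card_pos.2 ⟨φ e, mem_filter.2 ⟨mem_univ _,
          ⟨rfl, fun a b hab => (φ e).toHom.map_adj hab, fun _ => rfl⟩, (φ e).injective⟩⟩
      rw [h] at hpos
      obtain ⟨ψ, hψ⟩ := card_pos.1 hpos
      obtain ⟨⟨-, hadj, hcol⟩, hinj⟩ := (mem_filter.1 hψ).2
      exact ⟨ψ, mem_filter.2 ⟨mem_univ _, hadj, hinj⟩, funext hcol⟩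

end Main
end FracPacking

theorem theorem5 {U : Type w} [Finite U] (F : SimpleGraph U) (k : ℕ) (hk : 1 ≤ k)
    (hF : FracPacking.htw F ≤ (k : ℕ∞))
    {V : Type u} {W : Type v} [Fintype V] [Fintype W] (G : SimpleGraph V) (H : SimpleGraph W)
    (hGH : FracPacking.WLEquiv k G H) :
    FracPacking.fracPackingNumber F G = FracPacking.fracPackingNumber F H :=
  le_antisymm (FracPacking.WLEquiv.fracPackingNumber_le hk hF hGH)
    (FracPacking.WLEquiv.fracPackingNumber_le hk hF hGH.symm)
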